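/- For an integer $n\ge 1$ and $p\in[0,1]$ let $\mathcal G(n,p)$ be the binomial random graph on the vertex set $[n]=\{1,\dots,n\}$, in which each pair of vertices is an edge independently with probability $p$. For a finite graph $G$ and $k\in\mathbb N$, $k$ cops and one robber play the following game with perfect information. In round $0$ the cops choose their vertices (several cops may share a vertex) and then the robber chooses hers. In each round $t=1,2,\dots$ first every cop either stays or moves to an adjacent vertex, and then the robber either stays or moves to an adjacent vertex. The robber is captured in the first round in which she and some cop occupy the same vertex. The $k$-capture time $\mathrm{capt}_k(G)$ is the least $t\ge 0$ such that the cops have a strategy that captures the robber in round $t$ or earlier, whatever the robber does, and $\mathrm{capt}_k(G)=\infty$ if there is no such $t$. Theorem. There are absolute constants $c_1,c_2,C_0>0$ such that the following holds for every constant $C\ge C_0$. Let $p=p(n)\in[0,1]$ and $k=k(n)\in\mathbb N$ be such that, with $d=d(n)=p(n-1)$, $$d\ge \log^3 n\qquad\text{and}\qquad C\sqrt{n\log n}\le k<n$$ for all sufficiently large $n$ ($\log$ is the natural logarithm), and for these $n$ let $r=r(n)$ be the smallest positive integer such that $d^{\,r+1}\ge Cn\log n/k$. Then, for $G\in\mathcal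 G(n,p)$, $$c_1 r\le \mathrm{capt}_k(G)\le c_2 r$$ asymptotically almost surely, that is, with probability tending to $1$ as $n\to\infty$; in other words, a.a.s. $\mathrm{capt}_k(G)=\Theta(r)$. -/

import Mathlib

namespace CopsAndRobbers

variable {V : Type*}

/-- The moves of one player in one round on the reflexive graph `G`: stay, or cross an edge. -/
def Step (G : SimpleGraph V) (u v : V) : Prop :=
  u = v ∨ G.Adj u v

/-- A strategy for `k` cops on `G`. `S.pos h i` is the vertex occupied by cop `i` after the cops
have seen the list `h` of the robber's positions so far (in chronological order). In particular
`S.pos []` is the initial placement in round `0`, chosen before the robber appears. Several cops may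
share a vertex, and any subset of the cops may move in a given round. -/
structure CopStrategy (G : SimpleGraph V) (k : ℕ) where
  pos : List V → Fin k → V
  legal : ∀ (h : List V) (v : V) (i : Fin k), Step G (pos h i) (pos (h ++ [v]) i)

/-- A course of the robber: `ρ 0` is her initial vertex, `ρ t` her vertex at the end of
round `t`. -/
def IsRobberCourse (G : SimpleGraph V) (ρ : ℕ → V) : Prop :=
  ∀ t, Step G (ρ t) (ρ (t + 1))

/-- The robber's positions that the cops have seen when they move in round `t`,
that is `[ρ 0, …, ρ (t - 1)]`. -/
def seen (ρ : ℕ → V) (t : ℕ) : List V :=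
  (List.range t).map ρ

/-- In round `t` a cop and the robber occupy the same vertex. In round `0` this means that the
robber starts on a cop; in round `t + 1` either a cop moves onto the robber (who is still at `ρ t`),
or the robber moves onto a cop. -/
def CapturedInRound {G : SimpleGraph V} {k : ℕ} (S : CopStrategy G k) (ρ : ℕ → V) : ℕ → Prop
  | 0 => ∃ i, S.pos [] i = ρ 0
  | t + 1 => ∃ i, S.pos (seen ρ (t + 1)) i = ρ t ∨ S.pos (seen ρ (t + 1)) i = ρ (t + 1)

/-- The strategy `S` captures the robber after at most `t` rounds (not counting round `0`),
whatever the robber does. -/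
def CopStrategy.WinsWithin {G : SimpleGraph V} {k : ℕ} (S : CopStrategy G k) (t : ℕ) : Prop :=
  ∀ ρ : ℕ → V, IsRobberCourse G ρ → ∃ s ≤ t, CapturedInRound S ρ s

/-- The `k`-capture time of `G`: the least number of rounds within which `k` cops can force a
capture, and `⊤` if there is no such number. -/
noncomputable def captureTime (G : SimpleGraph V) (k : ℕ) : ℕ∞ :=
  sInf {T : ℕ∞ | ∃ t : ℕ, T = t ∧ ∃ S : CopStrategy G k, S.WinsWithin t}

end CopsAndRobbers

/-! Write L = log n. With probability at least 1 - 5/n, closed neighbourhoods behave as in a tree of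
degree d (`HasGrowth`): a set W expands by the factor d up to a relative error O(1/L) while |W|dL ≤
n, and by at least d/12 while |W|d ≤ n. As d ≥ L^3, Chernoff gives failure probability n^(-2|W|),
which survives a union bound over all W. Since r ≤ L/12, the errors accumulated over r rounds stay
bounded by constants.

Upper bound: the robber, starting at v, is after r rounds in the ball of radius r about v, which has
at most 3d^r vertices. If distinct cops can be sent to all of these vertices in r + 1 rounds, she is
caught. By Hall's theorem this needs at least |S| cops within distance r + 1 of every subset S of
that ball. This set has at least min(|S|d^(r+1), n)/24 vertices, so random placement puts enough
cops there when |S| is small (`exists_placement`). For larger S, a subset of S already has order k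
cops nearby, and k ≥ C√(nL) makes this exceed 3d^r (`captureTime_le_of_expansion`,
`HasGrowth.captureTime_le_succ`).

Lower bound: by minimality of r, k balls of radius ⌊(r-1)/2⌋ cannot cover the graph, and the robber
waits at an uncovered vertex (`HasGrowth.lt_captureTime`). -/

section

open MeasureTheory ProbabilityTheory

namespace CopsAndRobbers

/-! ### Chernoff bounds from joint avoidance probabilities. -/

section Prob

/-- The event that a binomial random graph avoids a given set of `m` possible edges has
probability `(1 - p) ^ m`. -/
theorem binomialRandom_real_avoid {V : Type*} [Finite V] (p : unitInterval) (F : Finset (Sym2 V))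
    (hF : ∀ e ∈ F, ¬ e.IsDiag) :
    (SimpleGraph.binomialRandom V p).real {G | ∀ e ∈ F, e ∉ G.edgeSet} = (1 - (p : ℝ)) ^ F.card := by
  classical
  have hm : MeasurableSet {s : Set (Sym2 V) | ∀ e ∈ F, e ∉ s} := by
    apply Set.Finite.measurableSet
    exact Set.toFinite _
  have h1 : SimpleGraph.binomialRandom V p {G | ∀ e ∈ F, e ∉ G.edgeSet} =
      setBernoulli (Sym2.diagSetᶜ : Set (Sym2 V)) p {s : Set (Sym2 V) | ∀ e ∈ F, e ∉ s} := by
    rw [SimpleGraph.binomialRandom_eq_map, Measure.map_apply (by fun_prop)]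
    · congr 1
      ext s
      simp only [Set.mem_preimage, Set.mem_ofPred_eq, SimpleGraph.edgeSet_fromEdgeSet, Set.mem_sdiff]
      refine forall₂_congr fun e he => ?_
      have := hF e he
      simp [this]
    · exact SimpleGraph.measurable_edgeSet hm
  have h2 : ((fun (q : Sym2 V → Prop) ↦ {i | q i}) ⁻¹' {s : Set (Sym2 V) | ∀ e ∈ F, e ∉ s}) =
      Set.pi (F : Set (Sym2 V)) (fun _ => ({False} : Set Prop)) := by
    ext q
    simp [Set.mem_pi]
  rw [measureReal_def, h1, setBernoulli_apply', h2, Measure.infinitePi_pi _ (by simp)]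
  rw [Finset.prod_congr rfl (g := fun _ => ((unitInterval.toNNReal (unitInterval.symm p) : NNReal) : ENNReal))]
  · simp
  · intro e he
    have := hF e he
    simp [this]

instance {V : Type*} [Countable V] : MeasurableSingletonClass (SimpleGraph V) where
  measurableSet_singleton G := by
    have : ({G} : Set (SimpleGraph V)) = SimpleGraph.edgeSet ⁻¹' {G.edgeSet} := by
      ext H; simp
    rw [this]
    exact SimpleGraph.measurable_edgeSet (measurableSet_singleton _)

variable {Ω ι : Type*} [Finite Ω] [MeasurableSpace Ω] [MeasurableSingletonClass Ω]
  {μ : Measure Ω} [IsProbabilityMeasure μ]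

-- Each factor of x^count is x + (1 - x)·1_{N u}; expanding the product over u leaves only the
-- probabilities in `h`. The result is the generating function of a binomial variable, so
-- independence need not be formulated.
open Classical in
theorem integral_pow_card_of_inter {N : ι → Set Ω} {U : Finset ι} {q : ℝ}
    (h : ∀ T ⊆ U, μ.real {ω | ∀ u ∈ T, ω ∈ N u} = q ^ T.card) (x : ℝ) :
    ∫ ω, x ^ (U.filter fun u => ω ∉ N u).card ∂μ = (x + (1 - x) * q) ^ U.card := by
  have h1 : ∀ ω, x ^ (U.filter fun u => ω ∉ N u).card =
      ∑ T ∈ U.powerset, (1 - x) ^ T.card * x ^ (U \ T).card *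
        Set.indicator {ω | ∀ u ∈ T, ω ∈ N u} 1 ω := by
    intro ω
    have : x ^ (U.filter fun u => ω ∉ N u).card =
        ∏ u ∈ U, ((1 - x) * Set.indicator (N u) 1 ω + x) := by
      rw [← Finset.prod_const, Finset.prod_filter]
      refine Finset.prod_congr rfl fun u _ => ?_
      by_cases hu : ω ∈ N u <;> simp [hu]
    rw [this, Finset.prod_add]
    refine Finset.sum_congr rfl fun T _ => ?_
    rw [Finset.prod_mul_distrib, Finset.prod_const, Finset.prod_const]
    have : ∏ i ∈ T, Set.indicator (N i) (1 : Ω → ℝ) ω =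
        Set.indicator {ω | ∀ u ∈ T, ω ∈ N u} 1 ω := by
      simp only [Set.indicator_apply, Pi.one_apply, Set.mem_ofPred_eq]
      rw [Finset.prod_ite_zero]
      simp
    rw [this]; ring
  simp_rw [h1]
  rw [integral_finsetSum _ fun _ _ => Integrable.of_finite]
  have h2 : ∀ T ∈ U.powerset, ∫ ω, (1 - x) ^ T.card * x ^ (U \ T).card *
        Set.indicator {ω | ∀ u ∈ T, ω ∈ N u} (1 : Ω → ℝ) ω ∂μ =
        ((1 - x) * q) ^ T.card * x ^ (U.card - T.card) := by
    intro T hT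
    rw [Finset.mem_powerset] at hT
    rw [integral_const_mul, integral_indicator_one (Set.toFinite _).measurableSet, h T hT,
      Finset.card_sdiff_of_subset hT, mul_pow]
    ring
  rw [Finset.sum_congr rfl h2, Finset.sum_pow_mul_eq_add_pow, add_comm]

-- Markov's inequality for exp(-l·count). The sign of `l` is left free: positive gives the lower
-- tail, negative the upper one.
open Classical in
theorem chernoff_of_inter {N : ι → Set Ω} {U : Finset ι} {q : ℝ} (hq0 : 0 ≤ q) (hq1 : q ≤ 1)
    (h : ∀ T ⊆ U, μ.real {ω | ∀ u ∈ T, ω ∈ N u} = q ^ T.card) (l m : ℝ) :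
    μ.real {ω | l * (U.filter fun u => ω ∉ N u).card ≤ l * m} ≤
      Real.exp (l * m - (1 - Real.exp (-l)) * ((1 - q) * U.card)) := by
  have hx := Real.exp_pos (-l)
  set x := Real.exp (-l) with hxd
  have hint := integral_pow_card_of_inter h x
  have hmk := mul_meas_ge_le_integral_of_nonneg (μ := μ)
    (f := fun ω => x ^ (U.filter fun u => ω ∉ N u).card)
    (Filter.Eventually.of_forall fun ω => by positivity) Integrable.of_finite (Real.exp (-(l * m)))
  rw [hint] at hmk
  have hset : {ω | l * (U.filter fun u => ω ∉ N u).card ≤ l * m} ⊆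
      {ω | Real.exp (-(l * m)) ≤ x ^ (U.filter fun u => ω ∉ N u).card} := by
    intro ω hω
    simp only [Set.mem_ofPred_eq] at hω ⊢
    rw [hxd, ← Real.exp_nat_mul, Real.exp_le_exp]
    linarith
  have hmono := measureReal_mono (μ := μ) hset
  have hbase : (x + (1 - x) * q) ^ U.card ≤ Real.exp (-((1 - x) * ((1 - q) * U.card))) := by
    have h0 : 0 ≤ x + (1 - x) * q := by nlinarith
    have h1 : x + (1 - x) * q ≤ Real.exp (-((1 - x) * (1 - q))) := by
      have := Real.add_one_le_exp (-((1 - x) * (1 - q)))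
      linarith
    calc _ ≤ Real.exp (-((1 - x) * (1 - q))) ^ U.card := pow_le_pow_left₀ h0 h1 _
      _ = _ := by rw [← Real.exp_nat_mul]; ring_nf
  have hE : Real.exp (l * m) * Real.exp (-(l * m)) = 1 := by rw [← Real.exp_add]; simp
  have hpos := Real.exp_pos (l * m)
  calc _ ≤ μ.real {ω | Real.exp (-(l * m)) ≤ x ^ (U.filter fun u => ω ∉ N u).card} := hmono
    _ = Real.exp (l * m) * (Real.exp (-(l * m)) *
        μ.real {ω | Real.exp (-(l * m)) ≤ x ^ (U.filter fun u => ω ∉ N u).card}) := by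
        rw [← mul_assoc, hE, one_mul]
    _ ≤ Real.exp (l * m) * Real.exp (-((1 - x) * ((1 - q) * U.card))) := by
        gcongr
        exact hmk.trans hbase
    _ = _ := by rw [← Real.exp_add]; ring_nf

theorem exp_neg_le_quadratic {e : ℝ} (he : 0 ≤ e) : Real.exp (-e) ≤ 1 - e + e ^ 2 / 2 := by
  have h1 := Real.quadratic_le_exp_of_nonneg he
  have h2 : Real.exp e * Real.exp (-e) = 1 := by rw [← Real.exp_add]; simp
  have h3 := Real.exp_pos (-e)
  have h4 : 0 ≤ 1 - e + e ^ 2 / 2 := by nlinarith [sq_nonneg (e - 1)]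
  have h5 : (1 - e + e ^ 2 / 2) * (1 + e + e ^ 2 / 2) = 1 + e ^ 4 / 4 := by ring
  by_contra! hc
  have h6 : (1 - e + e ^ 2 / 2) * (1 + e + e ^ 2 / 2) < 1 := by
    calc _ < Real.exp (-e) * (1 + e + e ^ 2 / 2) := by
          apply mul_lt_mul_of_pos_right hc; positivity
      _ ≤ Real.exp (-e) * Real.exp e := by gcongr
      _ = 1 := by rw [mul_comm, h2]
  have : 0 ≤ e ^ 4 / 4 := by positivity
  linarith

open Classical in
theorem chernoff_lower_tail {N : ι → Set Ω} {U : Finset ι} {q : ℝ} (hq0 : 0 ≤ q) (hq1 : q ≤ 1)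
    (h : ∀ T ⊆ U, μ.real {ω | ∀ u ∈ T, ω ∈ N u} = q ^ T.card) {e m : ℝ} (he : 0 < e)
    (hm0 : 0 ≤ m) (hm : m ≤ (1 - q) * U.card) :
    μ.real {ω | ((U.filter fun u => ω ∉ N u).card : ℝ) ≤ (1 - e) * m} ≤
      Real.exp (-(e ^ 2 * m / 2)) := by
  have h1 := chernoff_of_inter hq0 hq1 h e ((1 - e) * m)
  simp only [mul_le_mul_iff_right₀ he] at h1
  refine h1.trans (Real.exp_le_exp.2 ?_)
  have h2 := exp_neg_le_quadratic he.le
  have h3 : Real.exp (-e) ≤ 1 := by simpa using he.le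
  nlinarith

open Classical in
theorem chernoff_upper_tail {N : ι → Set Ω} {U : Finset ι} {q : ℝ} (hq0 : 0 ≤ q) (hq1 : q ≤ 1)
    (h : ∀ T ⊆ U, μ.real {ω | ∀ u ∈ T, ω ∈ N u} = q ^ T.card) {e : ℝ} (he : 0 < e) (he1 : e ≤ 1) :
    μ.real {ω | (1 + e) * ((1 - q) * U.card) ≤ (U.filter fun u => ω ∉ N u).card} ≤
      Real.exp (-(e ^ 2 * ((1 - q) * U.card) / 4)) := by
  -- With exp(e/2) ≤ 1 + e/2 + e²/4, the choice l = -e/2 gives the exponent -e²/4 times the mean.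
  have h1 := chernoff_of_inter hq0 hq1 h (-(e / 2)) ((1 + e) * ((1 - q) * U.card))
  have he' : 0 < e / 2 := by linarith
  simp only [neg_mul, neg_le_neg_iff, mul_le_mul_iff_right₀ he', neg_neg] at h1
  refine h1.trans (Real.exp_le_exp.2 ?_)
  have h2 := (abs_le.1 (Real.abs_exp_sub_one_sub_id_le (x := e / 2)
    (by rw [abs_of_pos he']; linarith))).2
  have h3 : 0 ≤ (1 - q) * U.card := mul_nonneg (by linarith) (by positivity)
  nlinarith

end Prob

/-! ### Expansion of vertex sets in the random graph. -/

section RandomGraph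

open Classical in
/-- The closed neighbourhood of a set of vertices. -/
noncomputable def closedNbhd {V : Type*} [Fintype V] (G : SimpleGraph V) (W : Finset V) : Finset V :=
  Finset.univ.filter fun u => ∃ w ∈ W, Step G w u

variable {V : Type*} [Fintype V] (p : unitInterval)

-- Supplies the hypothesis of the Chernoff bounds with q = (1 - p)^|W|; disjointness makes the pairs
-- w, u distinct possible edges.
open Classical in
theorem binomialRandom_real_no_edge_between (W T : Finset V) (hWT : Disjoint W T) :
    (SimpleGraph.binomialRandom V p).real {G | ∀ u ∈ T, G ∈ {G : SimpleGraph V | ∀ w ∈ W, ¬ G.Adj w u}} =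
      ((1 - (p : ℝ)) ^ W.card) ^ T.card := by
  have hne : ∀ w ∈ W, ∀ u ∈ T, w ≠ u := fun w hw u hu h =>
    Finset.disjoint_left.1 hWT hw (h ▸ hu)
  have h := binomialRandom_real_avoid p ((W ×ˢ T).image fun x => s(x.1, x.2)) (by
    simp only [Finset.mem_image, Finset.mem_product]
    rintro e ⟨⟨w, u⟩, ⟨hw, hu⟩, rfl⟩
    simpa using hne w hw u hu)
  rw [Finset.card_image_of_injOn, Finset.card_product, pow_mul] at h
  · rw [← h]
    congr 1
    ext G
    simp only [Set.mem_ofPred_eq, Finset.mem_image, Finset.mem_product]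
    constructor
    · rintro hG e ⟨⟨w, u⟩, ⟨hw, hu⟩, rfl⟩
      exact hG u hu w hw
    · intro hG u hu w hw
      exact hG s(w, u) ⟨(w, u), ⟨hw, hu⟩, rfl⟩
  · rintro ⟨w, u⟩ hx ⟨w', u'⟩ hy hxy
    simp only [Finset.coe_product, Set.mem_prod, Finset.mem_coe] at hx hy
    simp only [Sym2.eq_iff] at hxy
    rcases hxy with ⟨rfl, rfl⟩ | ⟨rfl, rfl⟩
    · rfl
    · exact absurd rfl (hne _ hx.1 _ hy.2)

open Classical in
theorem binomialRandom_real_closedNbhd_le (W : Finset V) {e m : ℝ} (he : 0 < e) (hm0 : 0 ≤ m)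
    (hm : m ≤ (1 - (1 - (p : ℝ)) ^ W.card) * (Fintype.card V - W.card)) :
    (SimpleGraph.binomialRandom V p).real
      {G | ((closedNbhd G W).card : ℝ) ≤ (1 - e) * m} ≤ Real.exp (-(e ^ 2 * m / 2)) := by
  have hp0 : 0 ≤ 1 - (p : ℝ) := sub_nonneg.2 p.2.2
  have hp1 : 1 - (p : ℝ) ≤ 1 := sub_le_self _ p.2.1
  have hcard : ((Wᶜ.card : ℕ) : ℝ) = Fintype.card V - W.card := by
    rw [Finset.card_compl, Nat.cast_sub (Finset.card_le_univ W)]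
  refine le_trans (measureReal_mono ?_) (chernoff_lower_tail (U := Wᶜ)
    (N := fun u => {G : SimpleGraph V | ∀ w ∈ W, ¬ G.Adj w u})
    (pow_nonneg hp0 W.card) (pow_le_one₀ hp0 hp1)
    (fun T hT => binomialRandom_real_no_edge_between p W T
      (Finset.disjoint_left.2 fun a ha hb => Finset.mem_compl.1 (hT hb) ha)) he hm0
    (by rw [hcard]; exact hm))
  intro G hG
  simp only [Set.mem_ofPred_eq] at hG ⊢
  refine le_trans ?_ hG
  exact_mod_cast Finset.card_le_card (fun u hu => by
    simp only [Finset.mem_filter, not_forall, not_not] at hu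
    obtain ⟨-, w, hw, hwu⟩ := hu
    simp only [closedNbhd, Finset.mem_filter, Finset.mem_univ, true_and]
    exact ⟨w, hw, Or.inr hwu⟩)

open Classical in
theorem binomialRandom_real_le_closedNbhd_singleton (v : V) {e : ℝ} (he : 0 < e) (he1 : e ≤ 1) :
    (SimpleGraph.binomialRandom V p).real
      {G | (1 + e) * (p * (Fintype.card V - 1)) + 1 ≤ ((closedNbhd G {v}).card : ℝ)} ≤
      Real.exp (-(e ^ 2 * (p * (Fintype.card V - 1)) / 4)) := by
  have hp0 : 0 ≤ 1 - (p : ℝ) := sub_nonneg.2 p.2.2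
  have hp1 : 1 - (p : ℝ) ≤ 1 := sub_le_self _ p.2.1
  have hcard : ((({v}ᶜ : Finset V).card : ℕ) : ℝ) = Fintype.card V - 1 := by
    rw [Finset.card_compl, Nat.cast_sub (Finset.card_le_univ _)]; simp
  have hmain := chernoff_upper_tail (U := {v}ᶜ)
    (N := fun u => {G : SimpleGraph V | ∀ w ∈ ({v} : Finset V), ¬ G.Adj w u})
    hp0 hp1 (fun T hT => by
      simpa using binomialRandom_real_no_edge_between p {v} T
        (Finset.disjoint_left.2 fun a ha hb => Finset.mem_compl.1 (hT hb) ha)) he he1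
  rw [hcard, sub_sub_cancel] at hmain
  refine le_trans (measureReal_mono ?_) hmain
  intro G hG
  simp only [Set.mem_ofPred_eq] at hG ⊢
  have hle : (closedNbhd G {v}).card ≤ (({v}ᶜ : Finset V).filter fun u =>
      G ∉ {G : SimpleGraph V | ∀ w ∈ ({v} : Finset V), ¬ G.Adj w u}).card + 1 := by
    refine le_trans (Finset.card_le_card ?_) (Finset.card_insert_le v _)
    intro u hu
    simp only [closedNbhd, Finset.mem_filter, Finset.mem_univ, true_and, Finset.mem_singleton,
      exists_eq_left, Step] at hu
    by_cases huv : u = v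
    · simp [huv]
    · have : G.Adj v u := hu.resolve_left fun h => huv h.symm
      simp [huv, this]
  have hle' : ((closedNbhd G {v}).card : ℝ) ≤ ((({v}ᶜ : Finset V).filter fun u =>
      G ∉ {G : SimpleGraph V | ∀ w ∈ ({v} : Finset V), ¬ G.Adj w u}).card : ℝ) + 1 := by
    exact_mod_cast hle
  simp only [Set.mem_ofPred_eq] at hle'
  linarith

/-- The typical behaviour of closed neighbourhoods in a random graph of average degree `d`, with
relative error `1 / L`. -/
structure HasGrowth (G : SimpleGraph V) (d L : ℝ) : Prop where
  upper : ∀ v, ((closedNbhd G {v}).card : ℝ) ≤ (1 + 3 / L) * d + 1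
  lower : ∀ W : Finset V, W.Nonempty → W.card * d * L ≤ Fintype.card V →
    (1 - 6 / L) * (W.card * d) ≤ (closedNbhd G W).card
  lower' : ∀ W : Finset V, W.Nonempty → W.card * d ≤ Fintype.card V →
    W.card * d / 12 ≤ (closedNbhd G W).card

/-- One bound for both regimes: nearly xw when xw is small, and at least xw/3 when xw ≤ 2. -/
theorem div_one_add_le_one_sub_pow {x : ℝ} (hx0 : 0 ≤ x) (hx1 : x ≤ 1) (w : ℕ) :
    (x * w) / (1 + x * w) ≤ 1 - (1 - x) ^ w := by
  have h1 : (1 - x) ^ w ≤ Real.exp (-(x * w)) := by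
    calc (1 - x) ^ w ≤ Real.exp (-x) ^ w :=
          pow_le_pow_left₀ (by linarith) (Real.one_sub_le_exp_neg x) _
      _ = _ := by rw [← Real.exp_nat_mul]; ring_nf
  have hxw : 0 ≤ x * w := by positivity
  have h2 : Real.exp (-(x * w)) ≤ 1 / (1 + x * w) := by
    rw [Real.exp_neg, ← one_div]
    apply one_div_le_one_div_of_le (by positivity)
    linarith [Real.add_one_le_exp (x * w)]
  have h3 : (x * w) / (1 + x * w) = 1 - 1 / (1 + x * w) := by field_simp; ring
  linarith

-- The union bound over sets: summing n^(-2|W|) over all W gives (1 + n^(-2))^n, which is 1 +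
-- O(1/n).
open Classical in
theorem sum_nonempty_pow_card_le {n : ℕ} (hn : Fintype.card V = n) (hn2 : 2 ≤ n) {f : Finset V → ℝ}
    (hf : ∀ W, W.Nonempty → f W ≤ (((n : ℝ) ^ 2)⁻¹) ^ W.card) :
    ∑ W ∈ (Finset.univ : Finset (Finset V)).filter Finset.Nonempty, f W ≤ 2 / n := by
  have hn0 : (2 : ℝ) ≤ n := by exact_mod_cast hn2
  calc _ ≤ ∑ W ∈ (Finset.univ : Finset (Finset V)).filter Finset.Nonempty,
        (((n : ℝ) ^ 2)⁻¹) ^ W.card :=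
        Finset.sum_le_sum fun W hW => hf W (Finset.mem_filter.1 hW).2
    _ = (∑ W : Finset V, (((n : ℝ) ^ 2)⁻¹) ^ W.card) - 1 := by
        have : (Finset.univ : Finset (Finset V)).filter Finset.Nonempty = Finset.univ.erase ∅ := by
          ext W; simp [Finset.nonempty_iff_ne_empty]
        rw [this, ← Finset.add_sum_erase _ _ (Finset.mem_univ (∅ : Finset V))]
        simp
    _ = (1 + ((n : ℝ) ^ 2)⁻¹) ^ n - 1 := by
        have := Finset.sum_pow_mul_eq_add_pow (((n : ℝ) ^ 2)⁻¹) 1 (Finset.univ : Finset V)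
        simp only [one_pow, mul_one, Finset.powerset_univ, Finset.card_univ, hn] at this
        rw [this, add_comm]
    _ ≤ Real.exp (1 / n) - 1 := by
        gcongr
        have h1 : 1 + ((n : ℝ) ^ 2)⁻¹ ≤ Real.exp (((n : ℝ) ^ 2)⁻¹) := by
          rw [add_comm]; exact Real.add_one_le_exp _
        calc _ ≤ Real.exp (((n : ℝ) ^ 2)⁻¹) ^ n := pow_le_pow_left₀ (by positivity) h1 _
          _ = _ := by rw [← Real.exp_nat_mul]; congr 1; field_simp
    _ ≤ 2 / n := by
        have h1 : 1 / (n : ℝ) ≤ 1 := by rw [div_le_one (by linarith)]; linarith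
        have h0 : 0 ≤ 1 / (n : ℝ) := by positivity
        have h2 := (abs_le.1 (Real.abs_exp_sub_one_sub_id_le (x := 1 / (n : ℝ))
          (by rw [abs_of_nonneg h0]; exact h1))).2
        have h3 : (2 : ℝ) / n = 1 / n + 1 / n := by ring
        nlinarith

theorem exp_neg_two_mul_log {n : ℕ} (hn : 2 ≤ n) (w : ℕ) {a : ℝ} (ha : 2 * w * Real.log n ≤ a) :
    Real.exp (-a) ≤ (((n : ℝ) ^ 2)⁻¹) ^ w := by
  have hn0 : (0 : ℝ) < n := by positivity
  have : (((n : ℝ) ^ 2)⁻¹) ^ w = Real.exp (-(2 * w * Real.log n)) := by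
    rw [Real.exp_neg, inv_pow, ← pow_mul]
    congr 1
    rw [show 2 * (w : ℝ) * Real.log n = ((2 * w : ℕ) : ℝ) * Real.log n by push_cast; ring,
      Real.exp_nat_mul, Real.exp_log hn0]
  rw [this, Real.exp_le_exp]
  linarith

/-! ### Failure probabilities and the union bound. -/

section Union

variable {p} {n : ℕ}

theorem five_thousand_le_of_le_log {n : ℕ} (hL : 100 ≤ Real.log n) : 5000 ≤ (n : ℝ) := by
  have hn : (0 : ℝ) < n := by
    rcases Nat.eq_zero_or_pos n with rfl | h
    · norm_num at hL
    · exact_mod_cast h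
  have h1 := Real.quadratic_le_exp_of_nonneg (x := Real.log n) (by linarith)
  rw [Real.exp_log hn] at h1
  nlinarith

theorem binomialRandom_real_closedNbhd_le_of_small
    (hn : Fintype.card V = n) (hL : 100 ≤ Real.log n) (hd : Real.log n ^ 3 ≤ p * ((n : ℝ) - 1))
    {W : Finset V} (hW : W.Nonempty)
    (h : (W.card : ℝ) * (p * ((n : ℝ) - 1)) * Real.log n ≤ n) :
    (SimpleGraph.binomialRandom V p).real {G | ((closedNbhd G W).card : ℝ) <
      (1 - 6 / Real.log n) * (W.card * (p * ((n : ℝ) - 1)))} ≤ (((n : ℝ) ^ 2)⁻¹) ^ W.card := by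
  have hn5 := five_thousand_le_of_le_log hL
  set L := Real.log n with hLdef
  set d := (p : ℝ) * ((n : ℝ) - 1) with hddef
  have hw : (1 : ℝ) ≤ W.card := by exact_mod_cast hW.card_pos
  set w := (W.card : ℝ) with hwdef
  have hd6 : 1000000 ≤ d := by nlinarith [pow_le_pow_left₀ (by norm_num) hL 3]
  have hL0 : 0 < L := by linarith
  set x := (p : ℝ) * w with hx
  have hp0 : 0 ≤ (p : ℝ) := p.2.1
  have hx0 : 0 ≤ x := by positivity
  have hxd : x * ((n : ℝ) - 1) = w * d := by rw [hx, hddef]; ring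
  have hxL : x ≤ 2 / L := by
    rw [le_div_iff₀ hL0]
    have : x * L * ((n : ℝ) - 1) ≤ 2 * ((n : ℝ) - 1) := by nlinarith
    exact le_of_mul_le_mul_right this (by linarith)
  have hwn : (n : ℝ) - w ≥ ((n : ℝ) - 1) * (1 - 1 / L) := by
    have h1 : w * L ≤ (n : ℝ) - 1 := by
      have : w * L * d ≤ n := by linarith
      have h2 : w * L * 2 ≤ w * L * d := by gcongr; linarith
      linarith
    have : w ≤ ((n : ℝ) - 1) / L := by rw [le_div_iff₀ hL0]; exact h1
    have e : ((n : ℝ) - 1) * (1 - 1 / L) = n - 1 - ((n : ℝ) - 1) / L := by ring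
    linarith
  have hLi : 1 / L ≤ 1 / 100 := one_div_le_one_div_of_le (by norm_num) hL
  have hLi0 : 0 < 1 / L := by positivity
  have hq : x * (1 - 2 / L) ≤ 1 - (1 - (p : ℝ)) ^ W.card := by
    refine le_trans ?_ (div_one_add_le_one_sub_pow hp0 p.2.2 _)
    rw [← hwdef, ← hx, le_div_iff₀ (by linarith)]
    have : (1 - 2 / L) * (1 + x) ≤ 1 := by nlinarith
    nlinarith
  -- Error budget: 2/L from the edge probability and 1/L from discarding W itself; the Chernoff
  -- deviation costs another 3/L, hence 6/L in total.
  have hm : w * d * (1 - 3 / L) ≤ (1 - (1 - (p : ℝ)) ^ W.card) * (Fintype.card V - W.card) := by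
    have e2 : 2 / L = 2 * (1 / L) := by ring
    have e3 : 3 / L = 3 * (1 / L) := by ring
    rw [hn, ← hwdef]
    have h1 : 0 ≤ 1 - 1 / L := by linarith
    have h2 : 0 ≤ x * (1 - 2 / L) := mul_nonneg hx0 (by linarith)
    calc w * d * (1 - 3 / L) ≤ (w * d) * ((1 - 2 / L) * (1 - 1 / L)) := by
          gcongr
          nlinarith
      _ = (x * (1 - 2 / L)) * (((n : ℝ) - 1) * (1 - 1 / L)) := by rw [← hxd]; ring
      _ ≤ _ := by
        refine mul_le_mul hq hwn (mul_nonneg (by linarith) h1) (h2.trans hq)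
  have hwd : 0 ≤ w * d := by nlinarith
  have hmain := binomialRandom_real_closedNbhd_le p W (e := 3 / L) (by positivity)
    (mul_nonneg hwd (by rw [show 3 / L = 3 * (1 / L) by ring]; linarith)) hm
  refine le_trans (measureReal_mono ?_) (hmain.trans (exp_neg_two_mul_log
    (by have : (2 : ℝ) ≤ n := by linarith
        exact_mod_cast this) _ ?_))
  · intro G hG
    simp only [Set.mem_ofPred_eq] at hG ⊢
    refine hG.le.trans ?_
    have : (1 - 6 / L) ≤ (1 - 3 / L) * (1 - 3 / L) := by
      have : 0 ≤ (3 / L) ^ 2 := by positivity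
      have e : 6 / L = 2 * (3 / L) := by ring
      nlinarith
    nlinarith
  -- The exponent is of order wd/L², so d ≥ L^3 is just what makes it at least 2wL.
  · rw [← hwdef, ← hLdef]
    have h1 : 2 * w * L = 2 / L ^ 2 * (w * L ^ 3) := by field_simp
    have h2 : (3 / L) ^ 2 * (w * d * (1 - 3 / L)) / 2 = (9 / 2 * (1 - 3 / L)) / L ^ 2 * (w * d) := by
      ring
    have h3 : 2 ≤ 9 / 2 * (1 - 3 / L) := by
      rw [show 3 / L = 3 * (1 / L) by ring]
      linarith
    rw [h1, h2]
    calc 2 / L ^ 2 * (w * L ^ 3) ≤ 2 / L ^ 2 * (w * d) := by gcongr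
      _ ≤ _ := by gcongr

theorem binomialRandom_real_closedNbhd_le_of_large
    (hn : Fintype.card V = n) (hL : 100 ≤ Real.log n) (hd : Real.log n ^ 3 ≤ p * ((n : ℝ) - 1))
    {W : Finset V} (hW : W.Nonempty)
    (h : (W.card : ℝ) * (p * ((n : ℝ) - 1)) ≤ n) :
    (SimpleGraph.binomialRandom V p).real {G | ((closedNbhd G W).card : ℝ) <
      W.card * (p * ((n : ℝ) - 1)) / 12} ≤ (((n : ℝ) ^ 2)⁻¹) ^ W.card := by
  have hn5 := five_thousand_le_of_le_log hL
  set L := Real.log n with hLdef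
  set d := (p : ℝ) * ((n : ℝ) - 1) with hddef
  have hw : (1 : ℝ) ≤ W.card := by exact_mod_cast hW.card_pos
  set w := (W.card : ℝ) with hwdef
  have hdL : 10000 * L ≤ d := by
    have : 10000 ≤ L ^ 2 := by nlinarith
    nlinarith
  set x := (p : ℝ) * w with hx
  have hp0 : 0 ≤ (p : ℝ) := p.2.1
  have hx0 : 0 ≤ x := by positivity
  have hxd : x * ((n : ℝ) - 1) = w * d := by rw [hx, hddef]; ring
  have hxL : x ≤ 2 := by
    have : x * ((n : ℝ) - 1) ≤ 2 * ((n : ℝ) - 1) := by nlinarith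
    exact le_of_mul_le_mul_right this (by linarith)
  have hwn : ((n : ℝ) - 1) / 2 ≤ (n : ℝ) - w := by nlinarith
  have hq : x / 3 ≤ 1 - (1 - (p : ℝ)) ^ W.card := by
    refine le_trans ?_ (div_one_add_le_one_sub_pow hp0 p.2.2 _)
    rw [← hwdef, ← hx]
    gcongr
    linarith
  -- A third from the edge probability and a half from the vertices outside W; Chernoff with e = 1/2
  -- turns 6 into 12.
  have hm : w * d / 6 ≤ (1 - (1 - (p : ℝ)) ^ W.card) * (Fintype.card V - W.card) := by
    rw [hn, ← hwdef]
    calc w * d / 6 = (x / 3) * (((n : ℝ) - 1) / 2) := by rw [← hxd]; ring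
      _ ≤ _ := mul_le_mul hq hwn (by linarith) (by linarith)
  have hwd : 0 ≤ w * d := by nlinarith
  have hmain := binomialRandom_real_closedNbhd_le p W (e := 1 / 2) (by norm_num)
    (by positivity) hm
  refine le_trans (measureReal_mono ?_) (hmain.trans (exp_neg_two_mul_log
    (by have : (2 : ℝ) ≤ n := by linarith
        exact_mod_cast this) _ ?_))
  · intro G hG
    simp only [Set.mem_ofPred_eq] at hG ⊢
    linarith
  · rw [← hwdef, ← hLdef]
    nlinarith

theorem binomialRandom_real_closedNbhd_singleton_gt
    (hn : Fintype.card V = n) (hL : 100 ≤ Real.log n) (hd : Real.log n ^ 3 ≤ p * ((n : ℝ) - 1))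
    (v : V) :
    (SimpleGraph.binomialRandom V p).real {G | (1 + 3 / Real.log n) * (p * ((n : ℝ) - 1)) + 1 <
      ((closedNbhd G {v}).card : ℝ)} ≤ ((n : ℝ) ^ 2)⁻¹ := by
  have hn5 := five_thousand_le_of_le_log hL
  have hL0 : 0 < Real.log n := by linarith
  have hmain := binomialRandom_real_le_closedNbhd_singleton p v (e := 3 / Real.log n) (by positivity)
    (by rw [div_le_one hL0]; linarith)
  rw [hn] at hmain
  refine le_trans (measureReal_mono ?_) (hmain.trans ((exp_neg_two_mul_log
    (by have : (2 : ℝ) ≤ n := by linarith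
        exact_mod_cast this) 1 ?_).trans (pow_one _).le))
  · intro G hG
    simp only [Set.mem_ofPred_eq] at hG ⊢
    exact hG.le
  · have h1 : 2 * ((1 : ℕ) : ℝ) * Real.log n = 2 / Real.log n ^ 2 * Real.log n ^ 3 := by
      field_simp; norm_num
    rw [h1, show (3 / Real.log n) ^ 2 * (p * ((n : ℝ) - 1)) / 4 =
      (9 / 4) / Real.log n ^ 2 * (p * ((n : ℝ) - 1)) by ring]
    gcongr
    norm_num

open Classical in
theorem binomialRandom_real_not_hasGrowth
    (hn : Fintype.card V = n) (hL : 100 ≤ Real.log n) (hd : Real.log n ^ 3 ≤ p * ((n : ℝ) - 1)) :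
    (SimpleGraph.binomialRandom V p).real
      {G | ¬ HasGrowth G (p * ((n : ℝ) - 1)) (Real.log n)} ≤ 5 / n := by
  have hn5 := five_thousand_le_of_le_log hL
  have hn2 : 2 ≤ n := by
    have : (2 : ℝ) ≤ n := by linarith
    exact_mod_cast this
  have hn0 : (0 : ℝ) < n := by linarith
  set μ := SimpleGraph.binomialRandom V p
  set d := (p : ℝ) * ((n : ℝ) - 1)
  set L := Real.log n
  set 𝒲 := (Finset.univ : Finset (Finset V)).filter Finset.Nonempty
  let A : V → Set (SimpleGraph V) := fun v => {G | (1 + 3 / L) * d + 1 < ((closedNbhd G {v}).card : ℝ)}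
  let B : Finset V → Set (SimpleGraph V) := fun W => if W.card * d * L ≤ n then
    {G | ((closedNbhd G W).card : ℝ) < (1 - 6 / L) * (W.card * d)} else ∅
  let B' : Finset V → Set (SimpleGraph V) := fun W => if W.card * d ≤ n then
    {G | ((closedNbhd G W).card : ℝ) < W.card * d / 12} else ∅
  have hsub : {G | ¬ HasGrowth G d L} ⊆
      (⋃ v ∈ Finset.univ, A v) ∪ ((⋃ W ∈ 𝒲, B W) ∪ (⋃ W ∈ 𝒲, B' W)) := by
    intro G hG
    by_contra hc
    simp only [Set.mem_union, Set.mem_iUnion, not_or, not_exists] at hc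
    obtain ⟨hA, hB, hB'⟩ := hc
    refine hG ⟨fun v => not_lt.1 (hA v (Finset.mem_univ _)), fun W hW h => ?_, fun W hW h => ?_⟩
    · have := hB W (by simpa [𝒲] using hW)
      rw [hn] at h
      simpa [B, h] using this
    · have := hB' W (by simpa [𝒲] using hW)
      rw [hn] at h
      simpa [B', h] using this
  have hA : ∑ v : V, μ.real (A v) ≤ 1 / n := by
    calc _ ≤ ∑ v : V, ((n : ℝ) ^ 2)⁻¹ :=
          Finset.sum_le_sum fun v _ => binomialRandom_real_closedNbhd_singleton_gt hn hL hd v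
      _ = 1 / n := by
          rw [Finset.sum_const, Finset.card_univ, hn, nsmul_eq_mul]; field_simp
  have hB : ∑ W ∈ 𝒲, μ.real (B W) ≤ 2 / n := by
    refine sum_nonempty_pow_card_le hn hn2 fun W hW => ?_
    by_cases h : W.card * d * L ≤ n
    · simp only [B, if_pos h]
      exact binomialRandom_real_closedNbhd_le_of_small hn hL hd hW h
    · simp only [B, if_neg h, measureReal_empty]
      positivity
  have hB' : ∑ W ∈ 𝒲, μ.real (B' W) ≤ 2 / n := by
    refine sum_nonempty_pow_card_le hn hn2 fun W hW => ?_
    by_cases h : W.card * d ≤ n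
    · simp only [B', if_pos h]
      exact binomialRandom_real_closedNbhd_le_of_large hn hL hd hW h
    · simp only [B', if_neg h, measureReal_empty]
      positivity
  calc _ ≤ μ.real ((⋃ v ∈ Finset.univ, A v) ∪ ((⋃ W ∈ 𝒲, B W) ∪ (⋃ W ∈ 𝒲, B' W))) :=
        measureReal_mono hsub
    _ ≤ μ.real (⋃ v ∈ Finset.univ, A v) + (μ.real (⋃ W ∈ 𝒲, B W) + μ.real (⋃ W ∈ 𝒲, B' W)) :=
        (measureReal_union_le _ _).trans (by gcongr; exact measureReal_union_le _ _)
    _ ≤ ∑ v : V, μ.real (A v) + (∑ W ∈ 𝒲, μ.real (B W) + ∑ W ∈ 𝒲, μ.real (B' W)) := by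
        gcongr <;> exact measureReal_biUnion_finset_le _ _
    _ ≤ 1 / n + (2 / n + 2 / n) := by gcongr
    _ = 5 / n := by ring

end Union

end RandomGraph

/-! ### Balls, cop strategies and capture. -/

section Game

variable {V : Type*} [Fintype V] {G : SimpleGraph V}

theorem Step.symm {V : Type*} {G : SimpleGraph V} {u v : V} (h : Step G u v) : Step G v u :=
  h.imp Eq.symm SimpleGraph.Adj.symm

theorem mem_closedNbhd {W : Finset V} {u : V} : u ∈ closedNbhd G W ↔ ∃ w ∈ W, Step G w u := by
  simp [closedNbhd]

theorem closedNbhd_mono {W W' : Finset V} (h : W ⊆ W') : closedNbhd G W ⊆ closedNbhd G W' := by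
  intro u hu
  rw [mem_closedNbhd] at hu ⊢
  obtain ⟨w, hw, hs⟩ := hu
  exact ⟨w, h hw, hs⟩

theorem subset_closedNbhd (W : Finset V) : W ⊆ closedNbhd G W := fun u hu =>
  mem_closedNbhd.2 ⟨u, hu, Or.inl rfl⟩

/-- The vertices that can be reached from `W` in `t` rounds. -/
noncomputable def ball (G : SimpleGraph V) (t : ℕ) (W : Finset V) : Finset V :=
  (closedNbhd G)^[t] W

@[simp] theorem ball_zero (W : Finset V) : ball G 0 W = W := rfl

theorem ball_succ (t : ℕ) (W : Finset V) : ball G (t + 1) W = closedNbhd G (ball G t W) :=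
  Function.iterate_succ_apply' _ _ _

theorem ball_succ' (t : ℕ) (W : Finset V) : ball G (t + 1) W = ball G t (closedNbhd G W) :=
  Function.iterate_succ_apply _ _ _

theorem ball_subset_ball {s t : ℕ} (h : s ≤ t) (W : Finset V) : ball G s W ⊆ ball G t W := by
  induction t, h using Nat.le_induction with
  | base => exact subset_rfl
  | succ t _ ih => rw [ball_succ]; exact ih.trans (subset_closedNbhd _)

theorem mem_ball_iff {t : ℕ} {W : Finset V} {u : V} :
    u ∈ ball G t W ↔ ∃ w ∈ W, u ∈ ball G t {w} := by
  induction t generalizing u with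
  | zero => simp
  | succ t ih =>
    simp only [ball_succ, mem_closedNbhd]
    constructor
    · rintro ⟨x, hx, hs⟩
      obtain ⟨w, hw, hxw⟩ := ih.1 hx
      exact ⟨w, hw, x, hxw, hs⟩
    · rintro ⟨w, hw, x, hxw, hs⟩
      exact ⟨x, ih.2 ⟨w, hw, hxw⟩, hs⟩

theorem mem_ball_singleton_comm {t : ℕ} {u v : V} : u ∈ ball G t {v} ↔ v ∈ ball G t {u} := by
  induction t generalizing u v with
  | zero => simp [eq_comm]
  | succ t ih =>
    rw [ball_succ, ball_succ', mem_closedNbhd, mem_ball_iff]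
    refine exists_congr fun w => ?_
    rw [mem_closedNbhd, ih, and_comm]
    simp only [Finset.mem_singleton, exists_eq_left]
    exact and_congr_left fun _ => ⟨Step.symm, Step.symm⟩

theorem IsRobberCourse.mem_ball {ρ : ℕ → V} (h : IsRobberCourse G ρ) (t : ℕ) :
    ρ t ∈ ball G t {ρ 0} := by
  induction t with
  | zero => simp
  | succ t ih => rw [ball_succ, mem_closedNbhd]; exact ⟨_, ih, h t⟩

theorem exists_course_of_mem_ball {t : ℕ} {u v : V} (h : u ∈ ball G t {v}) :
    ∃ ρ : ℕ → V, IsRobberCourse G ρ ∧ ρ 0 = v ∧ ρ t = u := by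
  induction t generalizing u with
  | zero => exact ⟨fun _ => v, fun _ => Or.inl rfl, rfl, by simpa [eq_comm] using h⟩
  | succ t ih =>
    rw [ball_succ, mem_closedNbhd] at h
    obtain ⟨w, hw, hs⟩ := h
    obtain ⟨ρ, hρ, h0, ht⟩ := ih hw
    refine ⟨fun s => if s ≤ t then ρ s else u, fun s => ?_, by simpa using h0, by simp⟩
    rcases lt_trichotomy s t with hst | rfl | hst
    · simpa [hst.le, Nat.succ_le_of_lt hst] using hρ s
    · simpa [ht] using hs
    · dsimp only
      rw [if_neg (by omega), if_neg (by omega)]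
      exact Or.inl rfl

variable {k : ℕ}

/-- The cops start at `f`; once the robber has chosen `v`, cop `i` walks along `path v i`. -/
def pathStrategy (f : Fin k → V) (path : V → Fin k → ℕ → V)
    (h0 : ∀ v i, path v i 0 = f i) (hp : ∀ v i, IsRobberCourse G (path v i)) : CopStrategy G k where
  pos
    | [], i => f i
    | v :: h, i => path v i (h.length + 1)
  legal
    | [], v, i => by simpa [h0] using hp v i 0
    | v :: h, w, i => by simpa using hp v i (h.length + 1)

theorem captureTime_le_of_winsWithin {V : Type*} {G : SimpleGraph V} (S : CopStrategy G k) {t : ℕ} (h : S.WinsWithin t) :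
    captureTime G k ≤ t :=
  sInf_le ⟨t, rfl, S, h⟩

/-- If the cops can be matched to all the vertices the robber may reach in `r` rounds, in such a
way that each cop reaches her vertex in `r + 1` rounds, they win in round `r + 1`. -/
theorem captureTime_le_of_matching (f : Fin k → V) (r : ℕ)
    (h : ∀ v, ∃ ψ : V → Fin k, Set.InjOn ψ (ball G r {v}) ∧
      ∀ u ∈ ball G r {v}, u ∈ ball G (r + 1) {f (ψ u)}) :
    captureTime G k ≤ (r + 1 : ℕ) := by
  choose ψ hinj hψ using h
  have hpath : ∀ v i, ∃ ρ : ℕ → V, IsRobberCourse G ρ ∧ ρ 0 = f i ∧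
      ∀ u ∈ ball G r {v}, ψ v u = i → ρ (r + 1) = u := by
    intro v i
    by_cases hi : ∃ u ∈ ball G r {v}, ψ v u = i
    · obtain ⟨u, hu, rfl⟩ := hi
      obtain ⟨ρ, h1, h2, h3⟩ := exists_course_of_mem_ball (hψ v u hu)
      exact ⟨ρ, h1, h2, fun u' hu' he => h3.trans (hinj v hu hu' he.symm)⟩
    · exact ⟨fun _ => f i, fun _ => Or.inl rfl, rfl, fun u hu he => absurd ⟨u, hu, he⟩ hi⟩
  choose path h1 h2 h3 using hpath
  refine captureTime_le_of_winsWithin (pathStrategy f path h2 h1) fun ρ hρ => ?_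
  -- The cops move first in round r + 1, so the robber is still at `ρ r` when the cop assigned to
  -- that vertex arrives.
  refine ⟨r + 1, le_rfl, ψ (ρ 0) (ρ r), Or.inl ?_⟩
  have hseen : seen ρ (r + 1) = ρ 0 :: (List.range r).map (fun i => ρ (i + 1)) := by
    simp [seen, List.range_succ_eq_map, Function.comp_def]
  rw [hseen]
  simp only [pathStrategy, List.length_map, List.length_range]
  exact h3 _ _ _ (hρ.mem_ball r) rfl

theorem CopStrategy.pos_mem_ball (S : CopStrategy G k) (i : Fin k) (h : List V) :
    S.pos h i ∈ ball G h.length {S.pos [] i} := by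
  induction h using List.reverseRecOn with
  | nil => simp
  | append_singleton h v ih =>
    rw [List.length_append, List.length_singleton, ball_succ, mem_closedNbhd]
    exact ⟨_, ih, S.legal h v i⟩

/-- If no `k` vertices dominate the graph at distance `t`, the robber survives `t` rounds. -/
theorem lt_captureTime_of_ball_ne_univ {t : ℕ}
    (h : ∀ W : Finset V, W.card ≤ k → ball G t W ≠ Finset.univ) : (t : ℕ∞) < captureTime G k := by
  classical
  rw [captureTime]
  by_contra! hc
  have hne : {T : ℕ∞ | ∃ t : ℕ, T = t ∧ ∃ S : CopStrategy G k, S.WinsWithin t}.Nonempty := by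
    by_contra hne
    rw [Set.not_nonempty_iff_eq_empty.1 hne] at hc
    simp at hc
  obtain ⟨t', ht', S, hS⟩ := csInf_mem hne
  rw [ht', Nat.cast_le] at hc
  set W := Finset.univ.image (S.pos [])
  have hW : W.card ≤ k := Finset.card_image_le.trans (by simp)
  obtain ⟨v, hv⟩ : ∃ v, v ∉ ball G t W := by
    by_contra! hall
    exact h W hW (Finset.eq_univ_of_forall hall)
  have key : ∀ i (l : List V), l.length ≤ t → S.pos l i ≠ v := by
    rintro i l hl rfl
    exact hv (ball_subset_ball hl _ (mem_ball_iff.2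
      ⟨S.pos [] i, Finset.mem_image_of_mem _ (Finset.mem_univ _), S.pos_mem_ball i l⟩))
  -- The robber simply stays at the undominated vertex.
  obtain ⟨s, hs, hcap⟩ := hS (fun _ => v) fun _ => Or.inl rfl
  cases s with
  | zero =>
    obtain ⟨i, hi⟩ := hcap
    exact key i [] (by simp) hi
  | succ s =>
    obtain ⟨i, hi⟩ := hcap
    rw [or_self] at hi
    exact key i _ (by simp [seen]; omega) hi

theorem card_ball_le {Δ : ℝ} (hΔ : 0 ≤ Δ) (h : ∀ v, ((closedNbhd G {v}).card : ℝ) ≤ Δ) (t : ℕ)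
    (W : Finset V) : ((ball G t W).card : ℝ) ≤ Δ ^ t * W.card := by
  classical
  induction t with
  | zero => simp
  | succ t ih =>
    have hsub : closedNbhd G (ball G t W) ⊆ (ball G t W).biUnion fun v => closedNbhd G {v} := by
      intro u hu
      simpa [mem_closedNbhd] using hu
    rw [ball_succ]
    calc ((closedNbhd G (ball G t W)).card : ℝ)
        ≤ ((∑ v ∈ ball G t W, (closedNbhd G {v}).card : ℕ) : ℝ) := by
          exact_mod_cast (Finset.card_le_card hsub).trans Finset.card_biUnion_le
      _ ≤ ∑ v ∈ ball G t W, Δ := by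
          rw [Nat.cast_sum]; exact Finset.sum_le_sum fun v _ => h v
      _ = Δ * (ball G t W).card := by rw [Finset.sum_const, nsmul_eq_mul, mul_comm]
      _ ≤ Δ * (Δ ^ t * W.card) := by gcongr
      _ = _ := by ring

end Game

/-! ### Random placement of the cops and Hall's theorem. -/

section Placement

variable {V : Type*} [Fintype V] {n k : ℕ}

-- Up to the factor n^k, the expectation of 2^(-X), X the number of cops in B, for independent
-- uniform cops: the sum factorises over the cops.
open Classical in
theorem sum_half_pow_card_filter (hn : Fintype.card V = n) (B : Finset V) :
    ∑ f : Fin k → V, (1 / 2 : ℝ) ^ (Finset.univ.filter fun i => f i ∈ B).card =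
      (n - (B.card : ℝ) / 2) ^ k := by
  have h1 : ∀ f : Fin k → V, (1 / 2 : ℝ) ^ (Finset.univ.filter fun i => f i ∈ B).card =
      ∏ i, if f i ∈ B then (1 / 2 : ℝ) else 1 := by
    intro f
    rw [← Finset.prod_filter, Finset.prod_const]
  simp_rw [h1]
  rw [← Fintype.sum_pow (fun v : V => if v ∈ B then (1 / 2 : ℝ) else 1)]
  congr 1
  have h2 : ∀ v : V, (if v ∈ B then (1 / 2 : ℝ) else 1) = 1 - if v ∈ B then (1 / 2 : ℝ) else 0 := by
    intro v; split_ifs <;> norm_num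
  simp_rw [h2]
  rw [Finset.sum_sub_distrib, Finset.sum_ite_mem]
  simp [hn]
  ring

open Classical in
/-- Some placement of `k` cops puts many cops into every member of a family of large sets. -/
theorem exists_placement (hn : Fintype.card V = n) (hn3 : 3 ≤ n) (B : Finset V → Finset V) (s₀ : ℕ)
    {b : ℝ} (hB : ∀ S : Finset V, S.Nonempty → S.card ≤ s₀ → S.card * b ≤ (B S).card)
    (hkb : 7 * n * Real.log n ≤ k * b) :
    ∃ f : Fin k → V, ∀ S : Finset V, S.Nonempty → S.card ≤ s₀ →
      S.card * (k * b / (4 * n)) ≤ (Finset.univ.filter fun i => f i ∈ B S).card := by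
  have hn0 : (3 : ℝ) ≤ n := by exact_mod_cast hn3
  set m := (k : ℝ) * b / (4 * n) with hm
  by_contra! hbad
  set 𝒲 := (Finset.univ : Finset (Finset V)).filter Finset.Nonempty
  -- 2^(|S|m - X) is at least 1 when S receives at most |S|m cops. `F S` bounds the average of this
  -- over all placements, by Markov's inequality.
  let F : Finset V → ℝ := fun S => if S.card ≤ s₀ then
    (2 : ℝ) ^ (S.card * m) * (1 - ((B S).card : ℝ) / (2 * n)) ^ k else 0
  have h1 : ∀ f : Fin k → V, (1 : ℝ) ≤ ∑ S ∈ 𝒲, if S.card ≤ s₀ then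
      (2 : ℝ) ^ (S.card * m) * (1 / 2 : ℝ) ^ (Finset.univ.filter fun i => f i ∈ B S).card else 0 := by
    intro f
    obtain ⟨S, hS, hs, hlt⟩ := hbad f
    refine le_trans ?_ (Finset.single_le_sum (fun T _ => ?_) (show S ∈ 𝒲 by simpa [𝒲] using hS))
    · rw [if_pos hs]
      rw [one_div, inv_pow, ← Real.rpow_natCast 2 (Finset.card _), ← div_eq_mul_inv,
        one_le_div (by positivity)]
      exact Real.rpow_le_rpow_of_exponent_le (by norm_num) hlt.le
    · split_ifs <;> positivity
  have h2 : ((n : ℝ) ^ k) ≤ ∑ S ∈ 𝒲, F S * n ^ k := by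
    calc ((n : ℝ) ^ k) = ∑ f : Fin k → V, (1 : ℝ) := by simp [hn]
      _ ≤ _ := Finset.sum_le_sum fun f _ => h1 f
      _ = _ := by
        rw [Finset.sum_comm]
        refine Finset.sum_congr rfl fun S _ => ?_
        by_cases hs : S.card ≤ s₀
        · simp only [F, if_pos hs]
          rw [← Finset.mul_sum, sum_half_pow_card_filter hn, mul_assoc, ← mul_pow]
          congr 2
          field_simp
        · simp [F, if_neg hs]
  rw [← Finset.sum_mul] at h2
  have h3 : ∑ S ∈ 𝒲, F S ≤ 2 / n := by
    refine sum_nonempty_pow_card_le hn (by omega) fun S hS => ?_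
    by_cases hs : S.card ≤ s₀
    · simp only [F, if_pos hs]
      have hBn : ((B S).card : ℝ) ≤ n := by rw [← hn]; exact_mod_cast Finset.card_le_univ _
      have h4 : (1 - ((B S).card : ℝ) / (2 * n)) ^ k ≤
          Real.exp (-(((B S).card : ℝ) / (2 * n) * k)) := by
        calc _ ≤ Real.exp (-(((B S).card : ℝ) / (2 * n))) ^ k := by
              refine pow_le_pow_left₀ ?_ (Real.one_sub_le_exp_neg _) _
              rw [sub_nonneg, div_le_one (by linarith)]
              linarith
          _ = _ := by rw [← Real.exp_nat_mul]; ring_nf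
      have h5 : (2 : ℝ) ^ (S.card * m) = Real.exp (Real.log 2 * (S.card * m)) :=
        Real.rpow_def_of_pos (by norm_num) _
      calc _ ≤ Real.exp (Real.log 2 * (S.card * m)) *
            Real.exp (-(((B S).card : ℝ) / (2 * n) * k)) := by rw [h5]; gcongr
        _ = Real.exp (-(((B S).card : ℝ) / (2 * n) * k - Real.log 2 * (S.card * m))) := by
            rw [← Real.exp_add]; ring_nf
        _ ≤ _ := by
          refine exp_neg_two_mul_log (by omega) _ ?_
          have h6 : (S.card : ℝ) * (2 * m) ≤ ((B S).card : ℝ) / (2 * n) * k := by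
            calc (S.card : ℝ) * (2 * m) = (S.card * b) / (2 * n) * k := by rw [hm]; ring
              _ ≤ _ := by gcongr; exact hB S hS hs
          -- The constant 7 ensures 2 log n + m log 2 ≤ 2m, where 2m per element of S bounds half
          -- the expected number of cops from below.
          have h7 : 7 * Real.log n ≤ 4 * m := by
            rw [hm, show 4 * ((k : ℝ) * b / (4 * n)) = k * b / n by ring, le_div_iff₀ (by linarith)]
            linarith
          have h8 := Real.log_two_lt_d9
          have h9 : 0 ≤ Real.log n := Real.log_nonneg (by linarith)
          have h10 : Real.log 2 * m ≤ 0.7 * m := by nlinarith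
          have h11 : 2 * Real.log n + Real.log 2 * m ≤ 2 * m := by linarith
          have h12 : (S.card : ℝ) * (2 * Real.log n + Real.log 2 * m) ≤ S.card * (2 * m) := by gcongr
          linarith
    · simp only [F, if_neg hs]; positivity
  have h4 : (2 : ℝ) / n < 1 := by rw [div_lt_one (by linarith)]; linarith
  have h5 : (0 : ℝ) < (n : ℝ) ^ k := by positivity
  nlinarith

variable {G : SimpleGraph V}

theorem ball_mono (G : SimpleGraph V) (t : ℕ) {W W' : Finset V} (h : W ⊆ W') :
    ball G t W ⊆ ball G t W' := by
  intro u hu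
  rw [mem_ball_iff] at hu ⊢
  obtain ⟨w, hw, hu⟩ := hu
  exact ⟨w, h hw, hu⟩

-- Hall's theorem for the vertices of the robber's ball against the cops within distance r + 1; a
-- ball around S is the union of the balls around its elements.
open Classical in
theorem captureTime_le_of_hall (f : Fin k → V) (r : ℕ)
    (h : ∀ v, ∀ S ⊆ ball G r {v},
      S.card ≤ (Finset.univ.filter fun i => f i ∈ ball G (r + 1) S).card) :
    captureTime G k ≤ (r + 1 : ℕ) := by
  refine captureTime_le_of_matching f r fun v => ?_
  let t : {u // u ∈ ball G r {v}} → Finset (Fin k) := fun u =>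
    Finset.univ.filter fun i => f i ∈ ball G (r + 1) {u.1}
  obtain ⟨g, hg, hgt⟩ := (Finset.all_card_le_biUnion_card_iff_exists_injective t).1 (by
    intro S
    have h1 := h v (S.map (Function.Embedding.subtype _)) (by
      intro u hu
      simp only [Finset.mem_map, Function.Embedding.subtype_apply] at hu
      obtain ⟨x, -, rfl⟩ := hu
      exact x.2)
    rw [Finset.card_map] at h1
    refine h1.trans (Finset.card_le_card ?_)
    intro i hi
    simp only [Finset.mem_filter, Finset.mem_univ, true_and] at hi
    rw [mem_ball_iff] at hi
    obtain ⟨w, hw, hi⟩ := hi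
    simp only [Finset.mem_map, Function.Embedding.subtype_apply] at hw
    obtain ⟨x, hx, rfl⟩ := hw
    simp only [Finset.mem_biUnion, t, Finset.mem_filter, Finset.mem_univ, true_and]
    exact ⟨x, hx, hi⟩)
  have hv : v ∈ ball G r {v} := ball_subset_ball (Nat.zero_le r) _ (by simp)
  refine ⟨fun u => if hu : u ∈ ball G r {v} then g ⟨u, hu⟩ else g ⟨v, hv⟩, ?_, ?_⟩
  · intro u hu u' hu' he
    simp only [Finset.mem_coe] at hu hu'
    simp only [hu, hu', dif_pos] at he
    exact congrArg Subtype.val (hg he)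
  · intro u hu
    simp only [hu, dif_pos]
    rw [mem_ball_singleton_comm]
    simpa [t] using hgt ⟨u, hu⟩

/-- If small sets expand to a fraction of the graph within `r + 1` rounds, while the balls of radius
`r` are small compared to the number of cops, the cops win in `r + 1` rounds. -/
theorem captureTime_le_of_expansion (hn : Fintype.card V = n) (hn3 : 3 ≤ n) {s₀ r : ℕ} {b : ℝ}
    (hB : ∀ S : Finset V, S.Nonempty → S.card ≤ s₀ → S.card * b ≤ (ball G (r + 1) S).card)
    (hkb : 7 * n * Real.log n ≤ k * b)
    (hball : ∀ v, ((ball G r {v}).card : ℝ) ≤ s₀ * (k * b / (4 * n))) :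
    captureTime G k ≤ (r + 1 : ℕ) := by
  classical
  obtain ⟨f, hf⟩ := exists_placement hn hn3 (ball G (r + 1)) s₀ hB hkb
  have hn0 : (3 : ℝ) ≤ n := by exact_mod_cast hn3
  have hlog : 1 ≤ Real.log n := by
    rw [Real.le_log_iff_exp_le (by linarith)]
    linarith [Real.exp_one_lt_d9]
  have hm : 1 ≤ k * b / (4 * n) := by
    rw [le_div_iff₀ (by linarith)]
    nlinarith
  refine captureTime_le_of_hall f r fun v S hS => ?_
  rcases S.eq_empty_or_nonempty with rfl | hne
  · simp
  rcases le_total S.card s₀ with hs | hs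
  · have h1 := hf S hne hs
    have h2 : (S.card : ℝ) ≤ S.card * (k * b / (4 * n)) := le_mul_of_one_le_right (by positivity) hm
    exact_mod_cast h2.trans h1
  -- The cops near any `s₀` elements of S already outnumber the whole ball of radius r.
  · obtain ⟨S', hS', hc⟩ := Finset.exists_subset_card_eq hs
    have hvs := hball v
    have hv : v ∈ ball G r {v} := ball_subset_ball (Nat.zero_le r) _ (by simp)
    have hpos : (1 : ℝ) ≤ (ball G r {v}).card := by exact_mod_cast Finset.card_pos.2 ⟨v, hv⟩
    have hs0 : S'.Nonempty := by
      rw [← Finset.card_pos, hc]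
      by_contra! h0
      have : s₀ = 0 := by omega
      rw [this, Nat.cast_zero, zero_mul] at hvs
      linarith
    have h1 := hf S' hs0 hc.le
    rw [hc] at h1
    have h2 : (S.card : ℝ) ≤ (ball G r {v}).card := by exact_mod_cast Finset.card_le_card hS
    have h3 : (Finset.univ.filter fun i => f i ∈ ball G (r + 1) S').card ≤
        (Finset.univ.filter fun i => f i ∈ ball G (r + 1) S).card :=
      Finset.card_le_card (Finset.monotone_filter_right _ fun i _ hi => ball_mono G _ hS' hi)
    have h4 := h2.trans (hvs.trans h1)
    exact (by exact_mod_cast h4 : S.card ≤ _).trans h3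

end Placement

/-! ### Growth of balls and the resulting bounds on the capture time. -/

section Growth

variable {V : Type*} [Fintype V] {G : SimpleGraph V} {d L : ℝ} {n : ℕ}

theorem HasGrowth.pow_le_card_ball (hG : HasGrowth G d L) (hn : Fintype.card V = n) (hL : 100 ≤ L)
    (hd : 1 ≤ d) {S : Finset V} (hS : S.Nonempty) {r : ℕ} (hr : 2 * S.card * d ^ r * L ≤ n)
    {i : ℕ} (hi : i ≤ r) : (1 - 6 / L) ^ i * d ^ i * S.card ≤ (ball G i S).card := by
  have hs : (1 : ℝ) ≤ S.card := by exact_mod_cast hS.card_pos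
  have h6 : 0 < 1 - 6 / L := by
    rw [sub_pos, div_lt_one (by linarith)]; linarith
  have h6' : 1 - 6 / L ≤ 1 := sub_le_self _ (by positivity)
  induction i with
  | zero => simp
  | succ i ih =>
    have ih := ih (by omega)
    set a := (1 - 6 / L) ^ i * d ^ i * S.card with ha
    have ha0 : 0 < a := by positivity
    -- The ball may be too large for `lower`, so it is trimmed to ⌈a⌉ vertices; the factor 2 in `hr`
    -- absorbs the rounding.
    obtain ⟨W, hW, hWc⟩ := Finset.exists_subset_card_eq (Nat.ceil_le.2 ih)
    have hWa : a ≤ W.card := by rw [hWc]; exact Nat.le_ceil a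
    have hWa' : (W.card : ℝ) ≤ a + 1 := by rw [hWc]; exact (Nat.ceil_lt_add_one ha0.le).le
    have hWne : W.Nonempty := by
      rw [← Finset.card_pos, hWc]; exact Nat.ceil_pos.2 ha0
    have ha1 : a ≤ S.card * d ^ i := by
      calc a = (1 - 6 / L) ^ i * (S.card * d ^ i) := by rw [ha]; ring
        _ ≤ 1 * (S.card * d ^ i) := by gcongr; exact pow_le_one₀ h6.le h6'
        _ = _ := one_mul _
    have hdi : 1 ≤ S.card * d ^ i := by nlinarith [one_le_pow₀ hd (n := i)]
    have hsmall : W.card * d * L ≤ Fintype.card V := by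
      rw [hn]
      calc W.card * d * L ≤ (2 * (S.card * d ^ i)) * d * L := by gcongr; linarith
        _ = 2 * S.card * d ^ (i + 1) * L := by ring
        _ ≤ 2 * S.card * d ^ r * L := by gcongr
        _ ≤ n := hr
    rw [ball_succ]
    calc (1 - 6 / L) ^ (i + 1) * d ^ (i + 1) * S.card = (1 - 6 / L) * (a * d) := by rw [ha]; ring
      _ ≤ (1 - 6 / L) * (W.card * d) := by gcongr
      _ ≤ (closedNbhd G W).card := hG.lower W hWne hsmall
      _ ≤ _ := by exact_mod_cast Finset.card_le_card (closedNbhd_mono hW)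

theorem HasGrowth.half_pow_le_card_ball (hG : HasGrowth G d L) (hn : Fintype.card V = n)
    (hL : 100 ≤ L) (hd : 1 ≤ d) {S : Finset V} (hS : S.Nonempty) {r : ℕ}
    (hr : 2 * S.card * d ^ r * L ≤ n) (hrL : 12 * r ≤ L) :
    S.card * d ^ r / 2 ≤ (ball G r S).card := by
  refine le_trans ?_ (hG.pow_le_card_ball hn hL hd hS hr le_rfl)
  have h6 : 6 / L ≤ 1 := by rw [div_le_one (by linarith)]; linarith
  have h1 := one_add_mul_le_pow (a := -(6 / L)) (by linarith) r
  have h2 : 1 / 2 ≤ 1 + r * -(6 / L) := by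
    have : (r : ℝ) * (6 / L) ≤ 1 / 2 := by
      rw [mul_div_assoc', div_le_iff₀ (by linarith)]
      linarith
    linarith
  calc S.card * d ^ r / 2 = (1 / 2) * d ^ r * S.card := by ring
    _ ≤ (1 - 6 / L) ^ r * d ^ r * S.card := by
      gcongr
      rw [sub_eq_add_neg]
      exact h2.trans h1

/-- The last round may saturate the graph, so it uses `lower'` on a set trimmed to about n/(2d)
vertices; 24 is 2 · 12. -/
theorem HasGrowth.min_le_card_ball (hG : HasGrowth G d L) (hn : Fintype.card V = n)
    (hL : 100 ≤ L) (hd : 1 ≤ d) (hdn : 2 * d ≤ n) {S : Finset V} (hS : S.Nonempty) {r : ℕ}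
    (hr : 2 * S.card * d ^ r * L ≤ n) (hrL : 12 * r ≤ L) :
    min (S.card * d ^ (r + 1)) n / 24 ≤ (ball G (r + 1) S).card := by
  have hs : (1 : ℝ) ≤ S.card := by exact_mod_cast hS.card_pos
  have hn0 : (0 : ℝ) < n := by linarith
  have hball := hG.half_pow_le_card_ball hn hL hd hS hr hrL
  set a := min (S.card * d ^ r / 2) (n / (2 * d)) with ha
  have ha0 : 0 < a := lt_min (by positivity) (by positivity)
  obtain ⟨W, hW, hWc⟩ := Finset.exists_subset_card_eq
    (Nat.ceil_le.2 ((min_le_left _ _).trans hball : a ≤ (ball G r S).card))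
  have hWa : a ≤ W.card := by rw [hWc]; exact Nat.le_ceil a
  have hWa' : (W.card : ℝ) ≤ a + 1 := by rw [hWc]; exact (Nat.ceil_lt_add_one ha0.le).le
  have hWne : W.Nonempty := by
    rw [← Finset.card_pos, hWc]; exact Nat.ceil_pos.2 ha0
  have hsmall : W.card * d ≤ Fintype.card V := by
    rw [hn]
    calc W.card * d ≤ (n / (2 * d) + 1) * d := by
          gcongr; exact hWa'.trans (by gcongr; exact min_le_right _ _)
      _ = n / 2 + d := by field_simp
      _ ≤ n := by linarith
  rw [ball_succ]
  calc min (S.card * d ^ (r + 1)) n / 24 = a * d / 12 := by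
        rw [ha, min_mul_of_nonneg _ _ (by linarith : 0 ≤ d), div_eq_mul_inv,
          div_eq_mul_inv (min _ _), min_mul_of_nonneg _ _ (by norm_num),
          min_mul_of_nonneg _ _ (by norm_num)]
        congr 1
        · ring
        · field_simp; norm_num
    _ ≤ W.card * d / 12 := by gcongr
    _ ≤ (closedNbhd G W).card := hG.lower' W hWne hsmall
    _ ≤ _ := by exact_mod_cast Finset.card_le_card (closedNbhd_mono hW)

theorem HasGrowth.card_ball_singleton_le (hG : HasGrowth G d L) (hL : 100 ≤ L) (hd : L ≤ d) {r : ℕ}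
    (hrL : 12 * r ≤ L) (v : V) : ((ball G r {v}).card : ℝ) ≤ 3 * d ^ r := by
  have hL0 : 0 < L := by linarith
  have hd0 : 0 < d := by linarith
  have hΔ : (1 + 3 / L) * d + 1 ≤ (1 + 4 / L) * d := by
    have : 1 ≤ 1 / L * d := by rw [div_mul_eq_mul_div, one_mul, one_le_div hL0]; exact hd
    have e : (1 + 4 / L) * d = (1 + 3 / L) * d + 1 / L * d := by ring
    linarith
  have h1 := card_ball_le (G := G) (Δ := (1 + 4 / L) * d) (by positivity)
    (fun v => (hG.upper v).trans hΔ) r {v}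
  rw [Finset.card_singleton, Nat.cast_one, mul_one, mul_pow] at h1
  refine h1.trans ?_
  gcongr
  calc (1 + 4 / L) ^ r ≤ Real.exp (4 / L) ^ r := by
        gcongr; rw [add_comm]; exact Real.add_one_le_exp _
    _ = Real.exp (r * (4 / L)) := by rw [← Real.exp_nat_mul]
    _ ≤ Real.exp 1 := by
        gcongr
        rw [mul_div_assoc', div_le_one hL0]
        linarith
    _ ≤ 3 := by linarith [Real.exp_one_lt_d9]

variable {k r : ℕ} {C : ℝ}

/-- Degrees are below 2d ≤ d², so k balls of radius t cover at most d^(2t)k ≤ d^(r-1)k vertices, and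
kd^r < CnL ≤ nd makes this less than n. -/
theorem HasGrowth.lt_captureTime (hG : HasGrowth G d L) (hn : Fintype.card V = n) (hL : 100 ≤ L)
    (hd : L ≤ d) (hCd : C * L ≤ d) (hkn : k < n) (hr : 2 ≤ r → k * d ^ r < C * n * L) :
    (((r - 1) / 2 : ℕ) : ℕ∞) < captureTime G k := by
  refine lt_captureTime_of_ball_ne_univ fun W hW huniv => ?_
  set t := (r - 1) / 2 with ht
  have hkn' : (k : ℝ) < n := by exact_mod_cast hkn
  have hL0 : 0 < L := by linarith
  have hΔ : (1 + 3 / L) * d + 1 ≤ 2 * d := by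
    have : 3 / L ≤ 3 / 100 := by gcongr
    nlinarith
  have h1 := card_ball_le (G := G) (Δ := 2 * d) (by linarith)
    (fun v => (hG.upper v).trans hΔ) t W
  rw [huniv, Finset.card_univ, hn] at h1
  have hW' : (W.card : ℝ) ≤ k := by exact_mod_cast hW
  have h2 : (n : ℝ) ≤ (2 * d) ^ t * k := h1.trans (by
    have : 0 ≤ (2 * d) ^ t := pow_nonneg (by linarith) _
    gcongr)
  rcases Nat.eq_zero_or_pos t with h0 | h0
  · rw [h0, pow_zero, one_mul] at h2
    linarith
  · have hr2 := hr (by omega)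
    have hd0 : 0 < d := by linarith
    have h3 : (2 * d) ^ t ≤ d ^ (r - 1) := by
      calc (2 * d) ^ t ≤ (d ^ 2) ^ t := by gcongr; nlinarith
        _ = d ^ (2 * t) := by rw [pow_mul]
        _ ≤ d ^ (r - 1) := by
          apply pow_le_pow_right₀ (by linarith); omega
    have h4 : k * d ^ (r - 1) * d < n * d := by
      calc k * d ^ (r - 1) * d = k * d ^ r := by
            rw [mul_assoc, ← pow_succ]; congr 2; omega
        _ < C * n * L := hr2
        _ = n * (C * L) := by ring
        _ ≤ n * d := by gcongr
    have h5 := lt_of_mul_lt_mul_right h4 hd0.le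
    have h6 : (2 * d) ^ t * k ≤ d ^ (r - 1) * k := by gcongr
    linarith

/-- So dense that a placement has a cop next to or on every vertex; 84 is 7 · 12. -/
theorem HasGrowth.captureTime_le_one (hG : HasGrowth G d (Real.log n)) (hn : Fintype.card V = n)
    (hL : 100 ≤ Real.log n) (hdn : d ≤ n) (hkd : 84 * n * Real.log n ≤ k * d) :
    captureTime G k ≤ 1 := by
  have hn5 := five_thousand_le_of_le_log hL
  have hn3 : 3 ≤ n := by
    have : (3 : ℝ) ≤ n := by linarith
    exact_mod_cast this
  refine captureTime_le_of_expansion (r := 0) (s₀ := 1) (b := d / 12) hn hn3 ?_ (by linarith) ?_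
  · intro S hS hs
    have hs1 : (S.card : ℝ) = 1 := by
      have : S.card = 1 := le_antisymm hs hS.card_pos
      exact_mod_cast this
    have := hG.lower' S hS (by rw [hs1, hn]; linarith)
    rw [ball_succ, ball_zero]
    linarith
  · intro v
    have : 1 ≤ k * (d / 12) / (4 * n) := by
      rw [le_div_iff₀ (by linarith)]
      nlinarith
    simpa using this

theorem HasGrowth.captureTime_le_succ (hG : HasGrowth G d (Real.log n)) (hn : Fintype.card V = n)
    (hL : 100 ≤ Real.log n) (hd : Real.log n ^ 3 ≤ d) (hC : 576 ≤ C)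
    (hk : C * Real.sqrt (n * Real.log n) ≤ k) (hr0 : 0 < r)
    (hr : C * n * Real.log n ≤ k * d ^ (r + 1)) (hr' : k * d ^ r ≤ C * n * Real.log n) :
    captureTime G k ≤ (r + 1 : ℕ) := by
  have hn5 := five_thousand_le_of_le_log hL
  have hn3 : 3 ≤ n := by
    have : (3 : ℝ) ≤ n := by linarith
    exact_mod_cast this
  have hn0 : (0 : ℝ) < n := by linarith
  have hexpn : Real.exp (Real.log n) = n := Real.exp_log hn0
  set L := Real.log n with hLdef
  have hd6 : 1000000 ≤ d := by nlinarith [pow_le_pow_left₀ (by norm_num) hL 3]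
  have hdL : 2 * L ≤ d := by
    have : 2 ≤ L ^ 2 := by nlinarith
    nlinarith
  have hnL : 4 * L ^ 3 ≤ n := by
    have := Real.pow_div_factorial_le_exp L (by linarith) 4
    rw [hexpn] at this
    norm_num [Nat.factorial] at this
    have h3 : 0 < L ^ 3 := by positivity
    nlinarith
  have hA : 0 < Real.sqrt (n * L) := Real.sqrt_pos.2 (by positivity)
  have hA2 : Real.sqrt (n * L) * Real.sqrt (n * L) = n * L := Real.mul_self_sqrt (by positivity)
  set A := Real.sqrt (n * L) with hAdef
  have hk0 : (0 : ℝ) < k := lt_of_lt_of_le (by positivity) hk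
  -- The threshold √(n log n) enters here: kd^r ≤ CA² ≤ kA, so the robber's ball has O(A) vertices,
  -- fewer than the cops.
  have hdrA : d ^ r ≤ A := by
    have : k * d ^ r ≤ k * A := by
      calc k * d ^ r ≤ C * n * L := hr'
        _ = (C * A) * A := by rw [mul_assoc C A, hA2]; ring
        _ ≤ k * A := by gcongr
    exact le_of_mul_le_mul_left this hk0
  have hkdr : 576 * d ^ r ≤ k := by
    calc 576 * d ^ r ≤ C * A := by gcongr
      _ ≤ k := hk
  have hAn : A * (2 * L) ≤ n := by
    have : A ≤ n / (2 * L) := by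
      rw [hAdef, Real.sqrt_le_left (by positivity), div_pow, le_div_iff₀ (by positivity)]
      calc (n : ℝ) * L * (2 * L) ^ (2 : ℕ) = n * (4 * L ^ 3) := by ring
        _ ≤ n * n := by gcongr
        _ = (n : ℝ) ^ 2 := by ring
    rwa [le_div_iff₀ (by positivity)] at this
  have hdrn : d ^ r * (2 * L) ≤ n := le_trans (by gcongr) hAn
  have hddr : d ≤ d ^ r := le_self_pow₀ (by linarith) (by omega)
  have hdn : 2 * d ≤ n := by nlinarith
  have hrL : 12 * (r : ℝ) ≤ L := by
    rw [← Real.exp_le_exp, hexpn]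
    calc Real.exp (12 * r) = (Real.exp 1 ^ 12) ^ r := by
          rw [← Real.exp_nat_mul, ← Real.exp_nat_mul]; congr 1; push_cast; ring
      _ ≤ d ^ r := by
          gcongr
          have h1 : Real.exp 1 ^ 12 ≤ 3 ^ 12 := by
            gcongr; linarith [Real.exp_one_lt_d9]
          exact h1.trans (by linarith)
      _ ≤ n := by nlinarith [pow_pos (by linarith : 0 < d) r]
  have hD0 : 0 < d ^ (r + 1) := by positivity
  have hLk : 576 * L ≤ k := by
    have : L ≤ A := by
      rw [hAdef]
      apply Real.le_sqrt_of_sq_le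
      have : L ≤ n := by nlinarith
      nlinarith
    calc 576 * L ≤ C * A := by gcongr
      _ ≤ k := hk
  set M := min (d ^ (r + 1)) (n : ℝ) with hM
  -- `s₀` is the largest size with s₀d^(r+1) ≤ n, or 1 if d^(r+1) ≥ n. Up to it expansion is
  -- unsaturated, and at it half of n is reached.
  obtain ⟨s₀, hs1, hs2, hs3⟩ : ∃ s₀ : ℕ, (n : ℝ) ≤ 2 * (s₀ * M) ∧
      (∀ s : ℕ, 0 < s → s ≤ s₀ → (s : ℝ) * M ≤ min (s * d ^ (r + 1)) n) ∧
      (∀ s : ℕ, 0 < s → s ≤ s₀ → 2 * s * d ^ r * L ≤ n) := by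
    rcases le_total (n : ℝ) (d ^ (r + 1)) with h | h
    · refine ⟨1, ?_, ?_, ?_⟩
      · rw [hM, min_eq_right h]; norm_num; linarith
      · intro s hs hs'
        have : s = 1 := by omega
        simp [this, hM]
      · intro s hs hs'
        have : s = 1 := by omega
        rw [this]; push_cast; linarith
    · have h1 : 1 ≤ n / d ^ (r + 1) := by rwa [one_le_div hD0]
      have h2 : ∀ s : ℕ, s ≤ ⌊n / d ^ (r + 1)⌋₊ → s * d ^ (r + 1) ≤ n := by
        intro s hs
        rw [← le_div_iff₀ hD0]
        exact (Nat.le_floor_iff (by positivity)).1 hs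
      refine ⟨⌊n / d ^ (r + 1)⌋₊, ?_, ?_, ?_⟩
      · rw [hM, min_eq_left h]
        have h3 := Nat.lt_floor_add_one (n / d ^ (r + 1))
        have h4 : (1 : ℝ) ≤ ⌊n / d ^ (r + 1)⌋₊ := by
          exact_mod_cast (Nat.le_floor_iff (by positivity)).2 (by simpa using h1)
        have h5 : n / d ^ (r + 1) ≤ 2 * ⌊n / d ^ (r + 1)⌋₊ := by linarith
        rw [div_le_iff₀ hD0] at h5
        linarith
      · intro s _ hs
        rw [hM, min_eq_left h, min_eq_left (h2 s hs)]
      · intro s _ hs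
        calc 2 * s * d ^ r * L = s * d ^ r * (2 * L) := by ring
          _ ≤ s * d ^ r * d := by gcongr
          _ = s * d ^ (r + 1) := by ring
          _ ≤ n := h2 s hs
  refine captureTime_le_of_expansion (s₀ := s₀) (b := M / 24) hn hn3 ?_ ?_ ?_
  · intro S hS hs
    refine le_trans ?_ (hG.min_le_card_ball hn hL (by linarith) hdn hS
      (hs3 S.card hS.card_pos hs) hrL)
    rw [mul_div_assoc']
    gcongr
    exact hs2 S.card hS.card_pos hs
  · have : 168 * n * L ≤ k * M := by
      rw [hM, mul_min_of_nonneg _ _ hk0.le]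
      refine le_min ?_ ?_
      · refine le_trans ?_ hr
        gcongr
        linarith
      · nlinarith
    linarith
  · intro v
    refine (hG.card_ball_singleton_le hL (by linarith) hrL v).trans ?_
    -- Here 192 = 2 · 4 · 24, and 576 = 3 · 192 explains the value of `C₀`.
    have h1 : s₀ * (k * (M / 24) / (4 * n)) = (2 * (s₀ * M)) * k / (192 * n) := by
      field_simp; ring
    rw [h1, le_div_iff₀ (by positivity)]
    calc 3 * d ^ r * (192 * n) = n * (576 * d ^ r) := by ring
      _ ≤ (2 * (s₀ * M)) * k := by gcongr

/-- In a graph with typical growth the capture time is of order `r`. -/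
theorem HasGrowth.exists_captureTime_eq (hG : HasGrowth G d (Real.log n))
    (hn : Fintype.card V = n) (hL : 100 ≤ Real.log n) (hd : Real.log n ^ 3 ≤ d) (hdn : d ≤ n)
    (hC : 576 ≤ C) (hCd : C * Real.log n ≤ d) (hkn : k < n)
    (hk : C * Real.sqrt (n * Real.log n) ≤ k) (hr0 : 0 < r)
    (hr : C * n * Real.log n ≤ k * d ^ (r + 1))
    (hr' : 2 ≤ r → k * d ^ r < C * n * Real.log n) :
    ∃ t : ℕ, captureTime G k = t ∧ 1 / 2 * (r : ℝ) ≤ t ∧ (t : ℝ) ≤ 2 * r := by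
  have hn5 := five_thousand_le_of_le_log hL
  have hdL : Real.log n ≤ d := by nlinarith
  have hup : captureTime G k ≤ (2 * r : ℕ) := by
    -- For r = 1 minimality gives no upper bound on kd, so the dense case is split off.
    rcases le_or_gt (84 * n * Real.log n) (k * d) with h | h
    · refine (hG.captureTime_le_one hn hL hdn h).trans ?_
      exact_mod_cast (by omega : 1 ≤ 2 * r)
    · refine (hG.captureTime_le_succ hn hL hd hC hk hr0 hr ?_).trans ?_
      · rcases Nat.lt_or_ge r 2 with h2 | h2
        · have : r = 1 := by omega
          rw [this, pow_one]
          refine h.le.trans ?_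
          gcongr
          linarith
        · exact (hr' h2).le
      · exact_mod_cast (by omega : r + 1 ≤ 2 * r)
  have hlow := hG.lt_captureTime hn hL hdL hCd hkn hr'
  obtain ⟨t, ht⟩ := ENat.ne_top_iff_exists.1 (ne_top_of_le_ne_top (ENat.natCast_ne_top _) hup)
  rw [← ht, Nat.cast_le] at hup
  rw [← ht, Nat.cast_lt] at hlow
  refine ⟨t, ht.symm, ?_, by exact_mod_cast hup⟩
  have : r ≤ 2 * t := by omega
  have : (r : ℝ) ≤ 2 * t := by exact_mod_cast this
  linarith

end Growth

end CopsAndRobbers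

end

/-! ### Assembly of the asymptotic statement. -/

theorem mainTheorem8 :
    ∃ c₁ c₂ C₀ : ℝ, 0 < c₁ ∧ 0 < c₂ ∧ 0 < C₀ ∧
      ∀ C : ℝ, C₀ ≤ C →
      ∀ (p : ℕ → unitInterval) (k r : ℕ → ℕ),
        (∀ᶠ n : ℕ in Filter.atTop, Real.log n ^ 3 ≤ (p n : ℝ) * ((n : ℝ) - 1)) →
        (∀ᶠ n : ℕ in Filter.atTop, C * Real.sqrt (n * Real.log n) ≤ (k n : ℝ) ∧ k n < n) →
        (∀ᶠ n : ℕ in Filter.atTop, IsLeast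
          {m : ℕ | 0 < m ∧
            C * n * Real.log n / (k n : ℝ) ≤ ((p n : ℝ) * ((n : ℝ) - 1)) ^ (m + 1)} (r n)) →
        Filter.Tendsto
          (fun n : ℕ => SimpleGraph.binomialRandom (Fin n) (p n)
            {G : SimpleGraph (Fin n) | ∃ t : ℕ, CopsAndRobbers.captureTime G (k n) = t ∧
              c₁ * (r n : ℝ) ≤ (t : ℝ) ∧ (t : ℝ) ≤ c₂ * (r n : ℝ)})
          Filter.atTop (nhds 1) := by
  refine ⟨1 / 2, 2, 576, by norm_num, by norm_num, by norm_num, ?_⟩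
  intro C hC p k r hd hk hr
  have hlog : Filter.Tendsto (fun n : ℕ => Real.log n) Filter.atTop Filter.atTop :=
    Real.tendsto_log_atTop.comp tendsto_natCast_atTop_atTop
  have hlim : Filter.Tendsto (fun n : ℕ => 1 - ENNReal.ofReal (5 / n)) Filter.atTop (nhds 1) := by
    have h1 : Filter.Tendsto (fun n : ℕ => ENNReal.ofReal (5 / n)) Filter.atTop (nhds 0) := by
      have := ENNReal.tendsto_ofReal (tendsto_const_div_atTop_nhds_zero_nat (5 : ℝ))
      simpa using this
    simpa using ENNReal.Tendsto.sub (tendsto_const_nhds (x := (1 : ENNReal))) h1 (by simp)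
  refine tendsto_of_tendsto_of_tendsto_of_le_of_le' hlim tendsto_const_nhds ?_
    (Filter.Eventually.of_forall fun n => MeasureTheory.prob_le_one)
  filter_upwards [hd, hk, hr, hlog.eventually_ge_atTop 100, hlog.eventually_ge_atTop C]
    with n hd ⟨hk, hkn⟩ hr hL hLC
  have hn5 := CopsAndRobbers.five_thousand_le_of_le_log hL
  set d := (p n : ℝ) * ((n : ℝ) - 1) with hddef
  have hbad := CopsAndRobbers.binomialRandom_real_not_hasGrowth (V := Fin n) (p := p n)
    (Fintype.card_fin n) hL hd
  have hk0 : (0 : ℝ) < k n := by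
    refine lt_of_lt_of_le ?_ hk
    have : 0 < Real.sqrt (n * Real.log n) := Real.sqrt_pos.2 (by nlinarith)
    nlinarith
  obtain ⟨⟨hr0, hr1⟩, hr2⟩ := hr
  rw [div_le_iff₀ hk0] at hr1
  have hsub : {G : SimpleGraph (Fin n) | CopsAndRobbers.HasGrowth G d (Real.log n)} ⊆
      {G : SimpleGraph (Fin n) | ∃ t : ℕ, CopsAndRobbers.captureTime G (k n) = t ∧
        1 / 2 * (r n : ℝ) ≤ (t : ℝ) ∧ (t : ℝ) ≤ 2 * (r n : ℝ)} := by
    intro G hG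
    refine hG.exists_captureTime_eq (C := C) (Fintype.card_fin n) hL hd ?_ hC ?_ hkn hk hr0
      (by linarith) ?_
    · have := (p n).2.2
      rw [hddef]
      nlinarith
    · calc C * Real.log n ≤ Real.log n * Real.log n := by gcongr
        _ ≤ Real.log n ^ 3 := by nlinarith [sq_nonneg (Real.log n)]
        _ ≤ d := hd
    · intro h2
      by_contra! hc
      -- Otherwise r - 1, positive since r ≥ 2, would contradict the minimality of r.
      have hmem : r n - 1 ∈ {m : ℕ | 0 < m ∧ C * n * Real.log n / (k n : ℝ) ≤ d ^ (m + 1)} := by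
        refine ⟨by omega, ?_⟩
        rw [div_le_iff₀ hk0, Nat.sub_add_cancel (by omega)]
        linarith
      have := hr2 hmem
      omega
  refine le_trans ?_ (MeasureTheory.measure_mono hsub)
  rw [tsub_le_iff_right]
  calc (1 : ENNReal) = SimpleGraph.binomialRandom (Fin n) (p n) Set.univ :=
        MeasureTheory.measure_univ.symm
    _ ≤ SimpleGraph.binomialRandom (Fin n) (p n)
          ({G | CopsAndRobbers.HasGrowth G d (Real.log n)} ∪
            {G | ¬ CopsAndRobbers.HasGrowth G d (Real.log n)}) :=
        MeasureTheory.measure_mono fun G _ => em _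
    _ ≤ _ := MeasureTheory.measure_union_le _ _
    _ ≤ _ := by
        gcongr
        rw [← MeasureTheory.ofReal_measureReal]
        exact ENNReal.ofReal_le_ofReal hbad
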